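/- Let $X=\Sigma_{(2,2,2,\dots)}=\{(x_n)_{n\ge 0}\in(\mathbb R/\mathbb Z)^{\mathbb N}: 2x_{n+1}=x_n \text{ for all } n\}$ be the dyadic solenoid, with the topology induced from the product of circles. Then $X$ is a compact Hausdorff second countable connected Abelian group containing no elements of order $2$, its character group $Y$ is discrete and isomorphic to $\mathbb Z[1/2]=\{m/2^n : m\in\mathbb Z,\ n\ge 0\}$, and the following holds. For each topological automorphism $\alpha$ of $X$ with $\alpha\neq I$ (where $I$ is the identity automorphism) and $\operatorname{Ker}(I+\alpha)=\{0\}$, there exist independent random variables $\xi_1,\xi_2$ with values in $X$ and distributions $\mu_1,\mu_2$ such that the conditional distribution of $L_2=\xi_1+\alpha\xi_2$ given $L_1=\xi_1+\xi_2$ is symmetric, while $\mu_1\notin\Gamma(X)*I(X)$ and $\mu_2\notin\Gamma(X)*I(X)$. Here $\Gamma(X)$ is the set of Gaussian distributions on $X$, that is, of the probability distributions $\gamma$ whose characteristic function has the form $\hat\gamma(y)=\int_X (t,y)\,d\gamma(t)=(x,y)\exp\{-\varphi(y)\}$, $y\in Y$, where $x\in X$, $(x,y)$ is the value of the character $y$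 at $x$, and $\varphi$ is a continuous nonnegative function on $Y$ with $\varphi(u+v)+\varphi(u-v)=2[\varphi(u)+\varphi(v)]$ for all $u,v\in Y$; $I(X)$ is the set of shifts of Haar distributions (normalized Haar measures) of compact subgroups of $X$; and $\Gamma(X)*I(X)$ is the set of convolutions $\gamma*\nu$ with $\gamma\in\Gamma(X)$, $\nu\in I(X)$. -/

import Mathlib

open MeasureTheory ProbabilityTheory

noncomputable section

/-- The `a`-adic solenoid `Σ_a`, as the inverse limit of the circles `ℝ/ℤ` along the maps
`x ↦ a n • x`, with the topology and Borel structure induced from the product of circles. -/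
def Solenoid (a : ℕ → ℕ) : AddSubgroup (ℕ → UnitAddCircle) where
  carrier := {x | ∀ n, a n • x (n + 1) = x n}
  zero_mem' := fun n => by simp
  add_mem' := fun {x y} hx hy n => by
    simp only [Pi.add_apply, smul_add, hx n, hy n]
  neg_mem' := fun {x} hx n => by
    simp only [Pi.neg_apply, smul_neg, hx n]

theorem Solenoid.isClosed (a : ℕ → ℕ) : IsClosed (Solenoid a : Set (ℕ → UnitAddCircle)) := by
  have h : (Solenoid a : Set (ℕ → UnitAddCircle)) =
      ⋂ n, {x : ℕ → UnitAddCircle | a n • x (n + 1) = x n} := by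
    ext x
    simp [Solenoid]
  rw [h]
  exact isClosed_iInter fun n => isClosed_eq (by fun_prop) (by fun_prop)

instance Solenoid.standardBorelSpace (a : ℕ → ℕ) : StandardBorelSpace (Solenoid a) :=
  (Solenoid.isClosed a).measurableSet.standardBorel

/-- The dyadic solenoid `Σ_(2,2,2,…)`. -/
abbrev DyadicSolenoid : AddSubgroup (ℕ → UnitAddCircle) := Solenoid fun _ => 2

/-- The group `H_a` of rational numbers of the form `m / (a 0 ⋯ a (n - 1))`. -/
def solenoidRationals (a : ℕ → ℕ) (ha : ∀ n, a n ≠ 0) : AddSubgroup ℚ where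
  carrier := {q | ∃ (m : ℤ) (n : ℕ), q = m / ∏ i ∈ Finset.range n, (a i : ℚ)}
  zero_mem' := ⟨0, 0, by simp⟩
  add_mem' := by
    have key : ∀ (m : ℤ) (n k : ℕ), ∃ m' : ℤ,
        (m : ℚ) / ∏ i ∈ Finset.range n, (a i : ℚ) =
          m' / ∏ i ∈ Finset.range (n + k), (a i : ℚ) := by
      intro m n k
      induction k with
      | zero => exact ⟨m, rfl⟩
      | succ k ih =>
        obtain ⟨m', h⟩ := ih
        refine ⟨m' * a (n + k), ?_⟩
        have h0 : (a (n + k) : ℚ) ≠ 0 := by exact_mod_cast ha (n + k)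
        rw [h, ← add_assoc, Finset.prod_range_succ]
        push_cast
        rw [mul_div_mul_right _ _ h0]
    rintro _ _ ⟨m, n, rfl⟩ ⟨m', n', rfl⟩
    obtain ⟨p, hp⟩ := key m n n'
    obtain ⟨q, hq⟩ := key m' n' n
    refine ⟨p + q, n + n', ?_⟩
    rw [hp, hq, add_comm n' n]
    push_cast
    rw [add_div]
  neg_mem' := by
    rintro _ ⟨m, n, rfl⟩
    exact ⟨-m, n, by push_cast; rw [neg_div]⟩

/-- The group `ℤ[1/2]` of dyadic rationals. -/
abbrev DyadicRationals : AddSubgroup ℚ := solenoidRationals (fun _ => 2) fun _ => two_ne_zero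

section LCA

variable (X : Type*) [AddCommGroup X] [TopologicalSpace X]

/-- The character group of `X`, written additively: continuous homomorphisms `X → ℝ/ℤ`,
with the compact-open topology. -/
abbrev CharGroup : Type _ := X →ₜ+ UnitAddCircle

variable {X}

/-- The value `(x, y) = exp (2πi y(x))` of the character `y` at `x`. -/
def charValue (x : X) (y : CharGroup X) : ℂ := (AddCircle.toCircle (y x) : ℂ)

variable [IsTopologicalAddGroup X] [MeasurableSpace X]

/-- The characteristic function (Fourier transform) of a distribution. -/
def characteristicFunction (μ : Measure X) (y : CharGroup X) : ℂ := ∫ x, charValue x y ∂μ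

/-- Gaussian distributions: `(x, y) exp (-φ y)` with `φ` continuous, nonnegative, quadratic. -/
def IsGaussianDistribution (γ : Measure X) : Prop :=
  IsProbabilityMeasure γ ∧
    ∃ (x : X) (φ : CharGroup X → ℝ), Continuous φ ∧ (∀ y, 0 ≤ φ y) ∧
      (∀ u v, φ (u + v) + φ (u - v) = 2 * (φ u + φ v)) ∧
      ∀ y, characteristicFunction γ y = charValue x y * (Real.exp (-φ y) : ℂ)

/-- Shifts of Haar distributions `m_K` of compact subgroups `K` of `X`. -/
def IsShiftedHaarDistribution (ν : Measure X) : Prop :=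
  ∃ K : AddSubgroup X, IsCompact (K : Set X) ∧
    ∃ m : Measure K, m.IsAddHaarMeasure ∧ IsProbabilityMeasure m ∧
      ∃ x : X, ν = m.map (fun k : K => x + (k : X))

/-- The class of convolutions of a Gaussian distribution with a shifted Haar distribution. -/
def gaussianConvHaar (X : Type*) [AddCommGroup X] [TopologicalSpace X]
    [IsTopologicalAddGroup X] [MeasurableSpace X] : Set (Measure X) :=
  {μ | ∃ γ ν : Measure X, IsGaussianDistribution γ ∧ IsShiftedHaarDistribution ν ∧
    μ = Measure.conv γ ν}

end LCA

/-- The conditional distribution of `η` given `ξ` is symmetric: for almost every value of `ξ` it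
is invariant under `x ↦ -x`. -/
def IsSymmetricCondDistrib {Ω X : Type*} [MeasurableSpace Ω] [AddCommGroup X] [MeasurableSpace X]
    [StandardBorelSpace X] (η ξ : Ω → X) (P : Measure Ω) [IsFiniteMeasure P] : Prop :=
  ∀ᵐ x ∂(P.map ξ), (condDistrib η ξ P x).map (fun z => -z) = condDistrib η ξ P x

end

/-! The characters of $X$ are the integer multiples of the coordinates, so $Y\cong\mathbb Z[1/2]$,
and every automorphism is multiplication by some $\pm 2^k$, $k\in\mathbb Z$. Elements of every odd
order $p>1$ exist in $X$, so injectivity of $I+\alpha$ together with $\alpha\ne I$ leaves only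
$\alpha=-2$ and its inverse (`apply_eq_or_symm_apply_eq`).

Both variables receive the density $1+\cos 2\pi x_0$ with respect to Haar measure. With $p$ the
zeroth coordinate, its characteristic function $F$ is $1$ at $0$, $1/2$ at $\pm p$ and $0$
elsewhere. Conditional symmetry follows from the identity $F(u+w)F(u-2w)=F(u-w)F(u+2w)$. If one side
is nonzero, then $3w=kp$ with $|k|\le 2$, which in $\mathbb Z[1/2]$ forces $w=0$, where the identity
is trivial (`characteristicFunction_cosineMeasure_mul_eq`, `eq_zero_of_three_zsmul_eq`).

For a law in $\Gamma(X)*I(X)$ the set where the characteristic function is nonzero is closed under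
doubling; here $F(p)\ne 0=F(2p)$. -/

/-! ### Characters and their values -/

section CharValue

variable {X : Type*} [AddCommGroup X] [TopologicalSpace X]

theorem charValue_zero (x : X) : charValue x 0 = 1 := by
  simp [charValue]

theorem charValue_add (x : X) (y z : CharGroup X) :
    charValue x (y + z) = charValue x y * charValue x z := by
  simp [charValue, AddCircle.toCircle_add]

theorem charValue_neg (x : X) (y : CharGroup X) :
    charValue x (-y) = star (charValue x y) := by
  have h : (-y) x = -(y x) := rfl
  simp [charValue, h, AddCircle.toCircle_neg, ← Circle.coe_inv_eq_conj]

theorem charValue_add_left (x x' : X) (y : CharGroup X) :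
    charValue (x + x') y = charValue x y * charValue x' y := by
  simp [charValue, AddCircle.toCircle_add]

theorem norm_charValue (x : X) (y : CharGroup X) : ‖charValue x y‖ = 1 :=
  Circle.norm_coe _

theorem charValue_ne_zero (x : X) (y : CharGroup X) : charValue x y ≠ 0 := by
  simp [charValue]

theorem charValue_eq_one_iff (x : X) (y : CharGroup X) : charValue x y = 1 ↔ y x = 0 := by
  rw [charValue, Circle.coe_eq_one, ← AddCircle.toCircle_zero (T := 1),
    (AddCircle.injective_toCircle one_ne_zero).eq_iff]

theorem continuous_charValue (y : CharGroup X) : Continuous fun x => charValue x y :=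
  continuous_subtype_val.comp (AddCircle.continuous_toCircle.comp y.continuous_toFun)

/-- The character `x ↦ (x, y)` as a continuous complex function. -/
noncomputable def charMap (y : CharGroup X) : C(X, ℂ) :=
  ⟨fun x => charValue x y, continuous_charValue y⟩

@[simp]
theorem charMap_apply (y : CharGroup X) (x : X) : charMap y x = charValue x y := rfl

theorem integrable_charValue [MeasurableSpace X] [OpensMeasurableSpace X]
    (μ : Measure X) [IsFiniteMeasure μ] (y : CharGroup X) :
    Integrable (fun x => charValue x y) μ :=
  Integrable.of_bound (continuous_charValue y).measurable.aestronglyMeasurable 1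
    (Filter.Eventually.of_forall fun x => (norm_charValue x y).le)

theorem integral_charValue_re [MeasurableSpace X] [OpensMeasurableSpace X]
    (μ : Measure X) [IsFiniteMeasure μ] (y : CharGroup X) :
    ∫ x, (charValue x y).re ∂μ = (characteristicFunction μ y).re :=
  integral_re (integrable_charValue μ y)

theorem integrable_charValue_re [MeasurableSpace X] [OpensMeasurableSpace X]
    (μ : Measure X) [IsFiniteMeasure μ] (y : CharGroup X) :
    Integrable (fun x => (charValue x y).re) μ :=
  (integrable_charValue μ y).re

theorem charValue_re_nonneg (x : X) (y : CharGroup X) : 0 ≤ 1 + (charValue x y).re := by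
  have h := Complex.abs_re_le_norm (charValue x y)
  rw [norm_charValue] at h
  linarith [(abs_le.1 h).1]

end CharValue

/-! ### Density of characters and uniqueness of the Fourier transform -/

section Density

theorem ContinuousMap.integrable_of_isFiniteMeasure {X : Type*} [TopologicalSpace X] [CompactSpace X]
    [MeasurableSpace X] [OpensMeasurableSpace X] (μ : Measure X) [IsFiniteMeasure μ]
    (f : C(X, ℂ)) : Integrable f μ :=
  Integrable.of_bound f.continuous.measurable.aestronglyMeasurable ‖f‖
    (Filter.Eventually.of_forall fun x => f.norm_coe_le_norm x)

variable {X : Type*} [AddCommGroup X] [TopologicalSpace X] [CompactSpace X]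

/-- A subgroup of characters separating the points of a compact group spans a dense subspace of the
continuous functions. -/
theorem span_charMap_dense (D : AddSubgroup (CharGroup X))
    (hD : ∀ x x' : X, x ≠ x' → ∃ y ∈ D, y x ≠ y x') :
    (Submodule.span ℂ (charMap '' (D : Set (CharGroup X)))).topologicalClosure = ⊤ := by
  let A : StarSubalgebra ℂ C(X, ℂ) :=
    { toSubalgebra := Algebra.adjoin ℂ (charMap '' (D : Set (CharGroup X)))
      star_mem' := by
        change Algebra.adjoin ℂ (charMap '' (D : Set (CharGroup X))) ≤
          star (Algebra.adjoin ℂ (charMap '' (D : Set (CharGroup X))))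
        refine Algebra.adjoin_le ?_
        rintro _ ⟨y, hy, rfl⟩
        refine Algebra.subset_adjoin ⟨-y, D.neg_mem hy, ?_⟩
        ext x
        simp [charValue_neg] }
  -- Products of characters in `D` stay in `D`, so the generated algebra is just the span and
  -- Stone–Weierstrass applies to it.
  have hspan : Subalgebra.toSubmodule A.toSubalgebra =
      Submodule.span ℂ (charMap '' (D : Set (CharGroup X))) := by
    refine Algebra.adjoin_eq_span_of_subset ℂ ?_
    refine Set.Subset.trans ?_ Submodule.subset_span
    intro f hf
    refine Submonoid.closure_induction (fun _ => id) ⟨0, D.zero_mem, ?_⟩ ?_ hf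
    · ext x; simp [charValue_zero]
    · rintro _ _ _ _ ⟨y, hy, rfl⟩ ⟨z, hz, rfl⟩
      exact ⟨y + z, D.add_mem hy hz, by ext x; simp [charValue_add]⟩
  have hsep : A.SeparatesPoints := by
    intro x x' hxx'
    obtain ⟨y, hy, hne⟩ := hD x x' hxx'
    refine ⟨_, ⟨charMap y, Algebra.subset_adjoin ⟨y, hy, rfl⟩, rfl⟩, fun h => hne ?_⟩
    exact AddCircle.injective_toCircle one_ne_zero (Circle.ext h)
  have htop := ContinuousMap.starSubalgebra_topologicalClosure_eq_top_of_separatesPoints A hsep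
  rw [← hspan]
  exact congr_arg (Subalgebra.toSubmodule <| StarSubalgebra.toSubalgebra ·) htop

variable [MeasurableSpace X] [OpensMeasurableSpace X]

/-- Integration against `g μ` as a continuous functional on continuous functions. -/
noncomputable def integralMulCLM (μ : Measure X) [IsFiniteMeasure μ] (g : C(X, ℂ)) :
    C(X, ℂ) →L[ℂ] ℂ :=
  LinearMap.mkContinuous
    { toFun := fun f => ∫ x, f x * g x ∂μ
      map_add' := fun f f' => by
        simp only [ContinuousMap.add_apply, add_mul]
        exact integral_add ((f * g).integrable_of_isFiniteMeasure μ)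
          ((f' * g).integrable_of_isFiniteMeasure μ)
      map_smul' := fun c f => by
        simp only [ContinuousMap.smul_apply, smul_eq_mul, mul_assoc, RingHom.id_apply]
        exact integral_const_mul c _ }
    (‖g‖ * μ.real Set.univ) fun f => by
      refine (norm_integral_le_of_norm_le_const (C := ‖f‖ * ‖g‖)
        (Filter.Eventually.of_forall fun x => ?_)).trans_eq (by ring)
      rw [norm_mul]
      gcongr
      exacts [f.norm_coe_le_norm x, g.norm_coe_le_norm x]

theorem integralMulCLM_apply {X : Type*} [TopologicalSpace X] [CompactSpace X] [MeasurableSpace X]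
    [OpensMeasurableSpace X] (μ : Measure X) [IsFiniteMeasure μ] (f g : C(X, ℂ)) :
    integralMulCLM μ g f = ∫ x, f x * g x ∂μ := rfl

/-- Finite measures on a compact group whose characters separate points are determined by their
characteristic functions. -/
theorem ext_of_characteristicFunction_eq [IsTopologicalAddGroup X] [BorelSpace X]
    [HasOuterApproxClosed X] {μ ν : Measure X} [IsFiniteMeasure μ] [IsFiniteMeasure ν]
    (hX : ∀ x x' : X, x ≠ x' → ∃ y : CharGroup X, y x ≠ y x')
    (h : ∀ y, characteristicFunction μ y = characteristicFunction ν y) : μ = ν := by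
  have hdense := span_charMap_dense (⊤ : AddSubgroup (CharGroup X))
    fun x x' hxx' => (hX x x' hxx').imp fun y hy => ⟨trivial, hy⟩
  have heq : integralMulCLM μ 1 = integralMulCLM ν 1 := by
    refine ContinuousLinearMap.ext_on (s := charMap '' ((⊤ : AddSubgroup (CharGroup X)) : Set _))
      ?_ ?_
    · rw [dense_iff_closure_eq, ← Submodule.topologicalClosure_coe, hdense]
      rfl
    · rintro _ ⟨y, -, rfl⟩
      simpa [integralMulCLM_apply, characteristicFunction] using h y
  refine ext_of_forall_integral_eq_of_IsFiniteMeasure fun f => ?_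
  have hf := DFunLike.congr_fun heq ⟨fun x => (f x : ℂ), by fun_prop⟩
  simp only [integralMulCLM_apply, ContinuousMap.coe_mk, ContinuousMap.one_apply, mul_one,
    integral_complex_ofReal] at hf
  exact_mod_cast hf

end Density

/-! ### Orthogonality of characters and duality for compact groups -/

section Haar

theorem characteristicFunction_zero {X : Type*} [AddCommGroup X] [TopologicalSpace X]
    [MeasurableSpace X] (μ : Measure X) [IsProbabilityMeasure μ] :
    characteristicFunction μ 0 = 1 := by
  simp [characteristicFunction, charValue_zero]

variable {X : Type*} [AddCommGroup X] [TopologicalSpace X] [IsTopologicalAddGroup X]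
  [MeasurableSpace X] [BorelSpace X]

/-- Nontrivial characters integrate to zero against an invariant measure. -/
theorem characteristicFunction_eq_zero_of_ne (μ : Measure X) [μ.IsAddLeftInvariant]
    {y : CharGroup X} (hy : y ≠ 0) : characteristicFunction μ y = 0 := by
  obtain ⟨t, ht⟩ : ∃ t, y t ≠ 0 := by
    by_contra! h
    exact hy (ContinuousAddMonoidHom.ext h)
  have h := integral_add_left_eq_self (μ := μ) (fun x => charValue x y) t
  simp only [charValue_add_left, integral_const_mul] at h
  by_contra h0
  exact ht ((charValue_eq_one_iff t y).1 (mul_right_cancel₀ h0 (h.trans (one_mul _).symm)))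

variable [CompactSpace X]

/-- A point-separating subgroup of the characters of a compact group contains every character. -/
theorem mem_of_separatesPoints (μ : Measure X) [IsProbabilityMeasure μ] [μ.IsAddLeftInvariant]
    (D : AddSubgroup (CharGroup X)) (hD : ∀ x x' : X, x ≠ x' → ∃ y ∈ D, y x ≠ y x')
    (y : CharGroup X) : y ∈ D := by
  by_contra hy
  -- If `y ∉ D`, integration against its conjugate kills `D`, hence everything by density; at `y`
  -- itself it gives 1.
  have heq : integralMulCLM μ (charMap (-y)) = 0 := by
    refine ContinuousLinearMap.ext_on (s := charMap '' (D : Set (CharGroup X))) ?_ ?_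
    · rw [dense_iff_closure_eq, ← Submodule.topologicalClosure_coe, span_charMap_dense D hD]
      rfl
    · rintro _ ⟨z, hz, rfl⟩
      have hzy : z + -y ≠ 0 := fun h => hy (by rwa [← add_neg_eq_zero.1 h])
      simpa [integralMulCLM_apply, characteristicFunction, charValue_add] using
        characteristicFunction_eq_zero_of_ne μ hzy
  have h := DFunLike.congr_fun heq (charMap y)
  simp [integralMulCLM_apply, ← charValue_add, charValue_zero] at h

/-- The character group of a compact group is discrete. -/
theorem discreteTopology_charGroup (μ : Measure X) [IsProbabilityMeasure μ]
    [μ.IsAddLeftInvariant] : DiscreteTopology (CharGroup X) := by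
  refine discreteTopology_of_isOpen_singleton_zero ?_
  let U : Set UnitAddCircle := {t | 1 / 2 < (AddCircle.toCircle t : ℂ).re}
  have hU : IsOpen U := isOpen_lt continuous_const
    (Complex.continuous_re.comp (continuous_subtype_val.comp AddCircle.continuous_toCircle))
  have hopen : IsOpen {y : CharGroup X | Set.MapsTo y Set.univ U} :=
    (ContinuousMap.isOpen_setOfPred_mapsTo isCompact_univ hU).preimage
      (ContinuousAddMonoidHom.isInducing_toContinuousMap X UnitAddCircle).continuous
  convert hopen
  ext y
  refine ⟨?_, fun h => ?_⟩
  · rintro rfl x -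
    simp [U]
    norm_num
  · by_contra hy
    -- A character with values in `U` has real part of mean at least 1/2, whereas a nontrivial one
    -- has mean 0.
    have hle : ∫ _, (1 / 2 : ℝ) ∂μ ≤ ∫ x, (charValue x y).re ∂μ :=
      integral_mono (integrable_const _) (integrable_charValue_re μ y)
        fun x => (h (Set.mem_univ x)).le
    rw [integral_charValue_re, characteristicFunction_eq_zero_of_ne μ hy] at hle
    norm_num at hle

end Haar

/-! ### Characteristic functions of the class Γ(X)*I(X) -/

section Convolution

variable {X : Type*} [AddCommGroup X] [TopologicalSpace X] [IsTopologicalAddGroup X]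
  [MeasurableSpace X] [BorelSpace X]

theorem characteristicFunction_conv [SecondCountableTopology X] (μ ν : Measure X)
    [IsFiniteMeasure μ] [IsFiniteMeasure ν] (y : CharGroup X) :
    characteristicFunction (Measure.conv μ ν) y =
      characteristicFunction μ y * characteristicFunction ν y := by
  have hmeas : AEStronglyMeasurable (fun x => charValue x y)
      ((μ.prod ν).map fun p : X × X => p.1 + p.2) :=
    (continuous_charValue y).measurable.aestronglyMeasurable
  rw [characteristicFunction, Measure.conv, integral_map (by fun_prop) hmeas]
  simp only [charValue_add_left]
  exact integral_prod_mul (μ := μ) (ν := ν) (fun x => charValue x y) fun x => charValue x y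

/-- The characteristic function of a shifted Haar distribution is supported on a subgroup. -/
theorem IsShiftedHaarDistribution.characteristicFunction_add_self_ne_zero {ν : Measure X}
    (hν : IsShiftedHaarDistribution ν) {y : CharGroup X}
    (hy : characteristicFunction ν y ≠ 0) : characteristicFunction ν (y + y) ≠ 0 := by
  obtain ⟨K, hK, m, hm, hprob, x, rfl⟩ := hν
  have key : ∀ z : CharGroup X, characteristicFunction (m.map fun k : K => x + (k : X)) z =
      charValue x z * characteristicFunction m
        (z.comp ⟨K.subtype, continuous_subtype_val⟩ : CharGroup K) := by
    intro z
    rw [characteristicFunction, integral_map (by fun_prop)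
      (continuous_charValue z).measurable.aestronglyMeasurable]
    simp only [charValue_add_left, integral_const_mul]
    rfl
  -- Nonvanishing at `y` means that `y` is trivial on `K`; then so is `2y`.
  have h0 : (y.comp ⟨K.subtype, continuous_subtype_val⟩ : CharGroup K) = 0 := by
    by_contra h
    rw [key, characteristicFunction_eq_zero_of_ne m h, mul_zero] at hy
    exact hy rfl
  have h1 : ((y + y).comp ⟨K.subtype, continuous_subtype_val⟩ : CharGroup K) = 0 := by
    refine ContinuousAddMonoidHom.ext fun k => ?_
    have hk : y (k : X) = 0 := DFunLike.congr_fun h0 k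
    change y (k : X) + y (k : X) = 0
    rw [hk, add_zero]
  rw [key, h1, characteristicFunction_zero, mul_one]
  exact charValue_ne_zero _ _

theorem characteristicFunction_add_self_ne_zero_of_mem_gaussianConvHaar
    [SecondCountableTopology X] {μ : Measure X} (hμ : μ ∈ gaussianConvHaar X) {y : CharGroup X}
    (hy : characteristicFunction μ y ≠ 0) : characteristicFunction μ (y + y) ≠ 0 := by
  obtain ⟨γ, ν, ⟨hγ, x, φ, -, -, -, hφ⟩, hν, rfl⟩ := hμ
  have hνprob : IsProbabilityMeasure ν := by
    obtain ⟨K, -, m, -, hm, x, rfl⟩ := hν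
    exact Measure.isProbabilityMeasure_map (by fun_prop)
  rw [characteristicFunction_conv] at hy ⊢
  refine mul_ne_zero ?_ (hν.characteristicFunction_add_self_ne_zero (right_ne_zero_of_mul hy))
  rw [hφ]
  exact mul_ne_zero (charValue_ne_zero _ _) (by exact_mod_cast (Real.exp_pos _).ne')

end Convolution

/-! ### Conditional symmetry from the joint law -/

section CondDistrib

/-- Disintegrations over the law of `ξ` are almost everywhere unique, so those of `η` and `-η` agree
as soon as the joint laws do. -/
theorem isSymmetricCondDistrib_of_map_eq {Ω X : Type*} [MeasurableSpace Ω] [AddCommGroup X]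
    [MeasurableSpace X] [StandardBorelSpace X] [MeasurableNeg X] {η ξ : Ω → X} {P : Measure Ω}
    [IsFiniteMeasure P] (hη : Measurable η)
    (h : P.map (fun ω => (ξ ω, η ω)) = P.map fun ω => (ξ ω, -η ω)) :
    IsSymmetricCondDistrib η ξ P := by
  have hneg : Measurable fun z : X => -z := measurable_neg
  have h1 : condDistrib η ξ P =ᵐ[P.map ξ] condDistrib ((fun z => -z) ∘ η) ξ P := by
    rw [condDistrib_ae_eq_iff_measure_eq_compProd ξ hη.aemeasurable,
      compProd_map_condDistrib (hneg.comp hη).aemeasurable, h]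
    rfl
  filter_upwards [h1, condDistrib_comp ξ hη.aemeasurable hneg] with x hx hx'
  rw [← Kernel.map_apply _ hneg, ← hx', hx]

end CondDistrib

/-! ### The cosine density and its functional equation -/

section CosineDensity

variable {X : Type*} [AddCommGroup X] [TopologicalSpace X] [IsTopologicalAddGroup X]
  [MeasurableSpace X] [BorelSpace X]

/-- The measure with density `1 + Re (x, p)` with respect to `m`. -/
noncomputable def cosineMeasure (m : Measure X) (p : CharGroup X) : Measure X :=
  m.withDensity fun x => ENNReal.ofReal (1 + (charValue x p).re)

theorem characteristicFunction_cosineMeasure {X : Type*} [AddCommGroup X] [TopologicalSpace X]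
    [MeasurableSpace X] [BorelSpace X] (m : Measure X) [IsProbabilityMeasure m] (p y : CharGroup X) :
    characteristicFunction (cosineMeasure m p) y = characteristicFunction m y +
      (characteristicFunction m (y + p) + characteristicFunction m (y - p)) / 2 := by
  have hmeas : Measurable fun x => ENNReal.ofReal (1 + (charValue x p).re) :=
    (measurable_const.add
      (Complex.measurable_re.comp (continuous_charValue p).measurable)).ennreal_ofReal
  rw [characteristicFunction, cosineMeasure, integral_withDensity_eq_integral_toReal_smul hmeas
    (Filter.Eventually.of_forall fun x => ENNReal.ofReal_lt_top)]
  have h : ∀ x, (ENNReal.ofReal (1 + (charValue x p).re)).toReal • charValue x y =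
      charValue x y + (charValue x (y + p) + charValue x (y - p)) / 2 := by
    intro x
    rw [ENNReal.toReal_ofReal (charValue_re_nonneg x p), sub_eq_add_neg, charValue_add,
      charValue_add, charValue_neg, Complex.real_smul]
    push_cast
    rw [Complex.re_eq_add_conj]
    simp only [Complex.star_def]
    ring
  simp only [h]
  have hsum : Integrable (fun x => charValue x (y + p) + charValue x (y - p)) m :=
    (integrable_charValue m _).add (integrable_charValue m _)
  rw [integral_add (integrable_charValue m y) (hsum.div_const 2), integral_div,
    integral_add (integrable_charValue m _) (integrable_charValue m _)]
  rfl

variable (m : Measure X) [IsProbabilityMeasure m] [m.IsAddLeftInvariant]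

theorem isProbabilityMeasure_cosineMeasure {p : CharGroup X} (hp : p ≠ 0) :
    IsProbabilityMeasure (cosineMeasure m p) := by
  refine ⟨?_⟩
  rw [cosineMeasure, withDensity_apply _ MeasurableSet.univ, Measure.restrict_univ,
    ← ofReal_integral_eq_lintegral_ofReal]
  · rw [integral_add (integrable_const _) (integrable_charValue_re m p), integral_charValue_re,
      characteristicFunction_eq_zero_of_ne m hp]
    simp
  · exact (integrable_const _).add (integrable_charValue_re m p)
  · exact Filter.Eventually.of_forall fun x => charValue_re_nonneg x p

theorem characteristicFunction_cosineMeasure_eq_zero {p y : CharGroup X} (h0 : y ≠ 0)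
    (h1 : y ≠ p) (h2 : y ≠ -p) : characteristicFunction (cosineMeasure m p) y = 0 := by
  rw [characteristicFunction_cosineMeasure, characteristicFunction_eq_zero_of_ne m h0,
    characteristicFunction_eq_zero_of_ne m (fun h => h2 (eq_neg_of_add_eq_zero_left h)),
    characteristicFunction_eq_zero_of_ne m (sub_ne_zero.2 h1)]
  simp

theorem characteristicFunction_cosineMeasure_self {p : CharGroup X} (hp : p ≠ 0)
    (hpp : p + p ≠ 0) : characteristicFunction (cosineMeasure m p) p = 1 / 2 := by
  rw [characteristicFunction_cosineMeasure, characteristicFunction_eq_zero_of_ne m hp,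
    characteristicFunction_eq_zero_of_ne m hpp, sub_self, characteristicFunction_zero]
  simp

/-- If the characters have no `3`-torsion and `p`, `2p` are not divisible by `3`, then in every
product `F (u + w) F (u - 2w)` of values of the characteristic function of the cosine measure with
`w ≠ 0` one factor vanishes. -/
theorem characteristicFunction_cosineMeasure_mul_eq {p : CharGroup X}
    (hp : ∀ (k : ℤ) (w : CharGroup X), |k| ≤ 2 → (3 : ℤ) • w = k • p → w = 0)
    (u w : CharGroup X) :
    characteristicFunction (cosineMeasure m p) (u + w) *
        characteristicFunction (cosineMeasure m p) (u - (2 : ℤ) • w) =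
      characteristicFunction (cosineMeasure m p) (u - w) *
        characteristicFunction (cosineMeasure m p) (u + (2 : ℤ) • w) := by
  have hcoef : ∀ y, characteristicFunction (cosineMeasure m p) y ≠ 0 →
      ∃ k : ℤ, |k| ≤ 1 ∧ y = k • p := by
    intro y hy
    by_contra! h
    refine hy (characteristicFunction_cosineMeasure_eq_zero m ?_ ?_ ?_)
    · simpa using h 0 (by simp)
    · simpa using h 1 (by simp)
    · simpa using h (-1) (by simp)
  have hvanish : ∀ w, w ≠ 0 → characteristicFunction (cosineMeasure m p) (u + w) *
      characteristicFunction (cosineMeasure m p) (u - (2 : ℤ) • w) = 0 := by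
    intro w hw
    by_contra h
    obtain ⟨k, hk, hka⟩ := hcoef _ (left_ne_zero_of_mul h)
    obtain ⟨l, hl, hlb⟩ := hcoef _ (right_ne_zero_of_mul h)
    -- Subtracting $u-2w=lp$ from $u+w=kp$ gives $3w=(k-l)p$.
    refine hw (hp (k - l) w ?_ ?_)
    · rw [abs_le] at *
      omega
    · rw [sub_zsmul, ← hka, ← hlb]
      module
  rcases eq_or_ne w 0 with rfl | hw
  · simp only [zsmul_zero, add_zero, sub_zero]
  · rw [hvanish w hw]
    have h := hvanish (-w) (neg_ne_zero.2 hw)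
    rw [← sub_eq_add_neg, zsmul_neg, sub_neg_eq_add] at h
    exact h.symm

end CosineDensity

/-! ### Topology and Haar measure of solenoids -/

section Topology

instance Solenoid.compactSpace (a : ℕ → ℕ) : CompactSpace (Solenoid a) :=
  isCompact_iff_compactSpace.1 (Solenoid.isClosed a).isCompact

instance Solenoid.secondCountableTopology (a : ℕ → ℕ) : SecondCountableTopology (Solenoid a) :=
  Topology.IsEmbedding.subtypeVal.secondCountableTopology

/-- The normalized Haar measure of a solenoid. -/
noncomputable def solenoidHaar (a : ℕ → ℕ) : Measure (Solenoid a) :=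
  Measure.addHaarMeasure ⊤

instance (a : ℕ → ℕ) : (solenoidHaar a).IsAddHaarMeasure :=
  Measure.isAddHaarMeasure_addHaarMeasure _

instance (a : ℕ → ℕ) : IsProbabilityMeasure (solenoidHaar a) :=
  ⟨Measure.addHaarMeasure_self (K₀ := (⊤ : TopologicalSpace.PositiveCompacts (Solenoid a)))⟩

end Topology

theorem charGroup_zsmul_apply {X : Type*} [AddCommGroup X] [TopologicalSpace X] (m : ℤ)
    (y : CharGroup X) (x : X) : (m • y) x = m • y x :=
  map_zsmul (⟨⟨fun y : CharGroup X => y x, rfl⟩, fun _ _ => rfl⟩ : CharGroup X →+ UnitAddCircle) m y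

/-! ### Structure of the dyadic solenoid and its dual -/

namespace DyadicSolenoid

theorem two_zsmul_apply_succ (x : DyadicSolenoid) (n : ℕ) :
    (2 : ℤ) • (x : ℕ → UnitAddCircle) (n + 1) = (x : ℕ → UnitAddCircle) n := by
  have h := x.2 n
  rw [← natCast_zsmul] at h
  exact_mod_cast h

theorem two_pow_zsmul_apply_add (x : DyadicSolenoid) (n k : ℕ) :
    (2 : ℤ) ^ k • (x : ℕ → UnitAddCircle) (n + k) = (x : ℕ → UnitAddCircle) n := by
  induction k with
  | zero => simp
  | succ k ih => rw [pow_succ, mul_zsmul, ← add_assoc, two_zsmul_apply_succ, ih]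

theorem eq_zero_of_two_pow_zsmul {x : DyadicSolenoid} (k : ℕ) (h : (2 : ℤ) ^ k • x = 0) :
    x = 0 := by
  refine Subtype.ext (funext fun n => ?_)
  rw [← two_pow_zsmul_apply_add x n k]
  exact congr_fun (congr_arg Subtype.val h) (n + k)

theorem addOrderOf_ne_two (x : DyadicSolenoid) : addOrderOf x ≠ 2 := by
  intro h
  have h2 : (2 : ℤ) ^ 1 • x = 0 := by
    have := addOrderOf_nsmul_eq_zero x
    rw [h, ← natCast_zsmul] at this
    exact_mod_cast this
  rw [eq_zero_of_two_pow_zsmul 1 h2, addOrderOf_zero] at h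
  norm_num at h

/-- Every element of the dyadic solenoid is divisible by `2 ^ k`. -/
theorem exists_two_pow_zsmul_eq (x : DyadicSolenoid) (k : ℕ) :
    ∃ z : DyadicSolenoid, (2 : ℤ) ^ k • z = x := by
  refine ⟨⟨fun n => (x : ℕ → UnitAddCircle) (n + k), fun n => ?_⟩, ?_⟩
  · have h := x.2 (n + k)
    rwa [add_right_comm] at h
  · exact Subtype.ext (funext fun n => two_pow_zsmul_apply_add x n k)

/-- The one-parameter subgroup `r ↦ (r / 2 ^ n)`. -/
noncomputable def line (r : ℝ) : DyadicSolenoid :=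
  ⟨fun n => ((r / 2 ^ n : ℝ) : UnitAddCircle), fun n => by
    rw [← AddCircle.coe_nsmul]
    congr 1
    rw [nsmul_eq_mul]
    push_cast
    field_simp
    ring⟩

theorem line_apply (r : ℝ) (n : ℕ) :
    (line r : ℕ → UnitAddCircle) n = ((r / 2 ^ n : ℝ) : UnitAddCircle) := rfl

theorem continuous_line : Continuous line :=
  Continuous.subtype_mk (continuous_pi fun _ =>
    (AddCircle.continuous_mk' 1).comp (continuous_id.div_const _)) _

theorem exists_line_apply_eq (x : DyadicSolenoid) (n : ℕ) :
    ∃ r, ∀ k ≤ n, (line r : ℕ → UnitAddCircle) k = (x : ℕ → UnitAddCircle) k := by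
  obtain ⟨t, ht⟩ := QuotientAddGroup.mk_surjective ((x : ℕ → UnitAddCircle) n)
  refine ⟨2 ^ n * t, fun k hk => ?_⟩
  obtain ⟨j, rfl⟩ := Nat.exists_eq_add_of_le hk
  rw [← two_pow_zsmul_apply_add x, ← two_pow_zsmul_apply_add (line _), line_apply,
    mul_div_cancel_left₀ _ (by positivity)]
  exact congr_arg _ ht

/-- Each coordinate determines the earlier ones, so the line matches any point on any initial
segment of coordinates, which is all the product topology sees. -/
theorem denseRange_line : DenseRange line := by
  intro x
  choose r hr using exists_line_apply_eq x
  refine mem_closure_of_tendsto (f := fun n => line (r n)) (b := Filter.atTop) ?_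
    (Filter.Eventually.of_forall fun n => Set.mem_range_self _)
  rw [tendsto_subtype_rng, tendsto_pi_nhds]
  intro k
  refine tendsto_const_nhds.congr' ?_
  filter_upwards [Filter.eventually_ge_atTop k] with n hn
  exact (hr n k hn).symm

instance connectedSpace : ConnectedSpace DyadicSolenoid :=
  { denseRange_line.preconnectedSpace continuous_line with toNonempty := ⟨0⟩ }

/-- The coordinate characters of the dyadic solenoid. -/
def coordChar (n : ℕ) : CharGroup DyadicSolenoid :=
  ⟨⟨⟨fun x => (x : ℕ → UnitAddCircle) n, rfl⟩, fun _ _ => rfl⟩,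
    (continuous_apply n).comp continuous_subtype_val⟩

theorem coordChar_apply (n : ℕ) (x : DyadicSolenoid) :
    coordChar n x = (x : ℕ → UnitAddCircle) n := rfl

theorem two_pow_zsmul_coordChar_add (n k : ℕ) :
    (2 : ℤ) ^ k • coordChar (n + k) = coordChar n := by
  refine ContinuousAddMonoidHom.ext fun x => ?_
  rw [charGroup_zsmul_apply]
  exact two_pow_zsmul_apply_add x n k

theorem zsmul_coordChar_eq_zero_iff {m : ℤ} {n : ℕ} : m • coordChar n = 0 ↔ m = 0 := by
  refine ⟨fun h => ?_, fun h => by rw [h, zero_zsmul]⟩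
  by_contra hm
  have hm' : (m : ℝ) ≠ 0 := by exact_mod_cast hm
  -- The test point has `n`-th coordinate $1/(2m)$, where `m • coordChar n` takes the value $1/2\ne
  -- 0$.
  have h1 := DFunLike.congr_fun h (line (2 ^ n * (1 / (2 * m))))
  rw [charGroup_zsmul_apply, coordChar_apply, line_apply, mul_div_cancel_left₀ _ (by positivity),
    ← AddCircle.coe_zsmul] at h1
  obtain ⟨j, hj⟩ := (AddCircle.coe_eq_zero_iff (1 : ℝ)).1 h1
  simp only [zsmul_eq_mul, mul_one] at hj
  have h2 : (j : ℝ) * 2 = 1 := by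
    rw [hj]
    field_simp
  have h3 : j * 2 = 1 := by exact_mod_cast h2
  omega

theorem zsmul_coordChar_eq_iff {m m' : ℤ} {n n' : ℕ} :
    m • coordChar n = m' • coordChar n' ↔ m * 2 ^ n' = m' * 2 ^ n := by
  rw [← two_pow_zsmul_coordChar_add n n', ← two_pow_zsmul_coordChar_add n' n, add_comm n' n,
    ← mul_zsmul, ← mul_zsmul, ← sub_eq_zero, sub_eq_add_neg, ← sub_zsmul, zsmul_coordChar_eq_zero_iff,
    sub_eq_zero]

theorem zsmul_coordChar_add (m m' : ℤ) (n n' : ℕ) :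
    m • coordChar n + m' • coordChar n' = (m * 2 ^ n' + m' * 2 ^ n) • coordChar (n + n') := by
  rw [← two_pow_zsmul_coordChar_add n n', ← two_pow_zsmul_coordChar_add n' n, add_comm n' n,
    ← mul_zsmul, ← mul_zsmul, ← add_zsmul]

/-- Every character of the dyadic solenoid is an integer multiple of a coordinate. -/
theorem exists_eq_zsmul_coordChar (y : CharGroup DyadicSolenoid) :
    ∃ (m : ℤ) (n : ℕ), y = m • coordChar n := by
  let D : AddSubgroup (CharGroup DyadicSolenoid) :=
    { carrier := {y | ∃ (m : ℤ) (n : ℕ), y = m • coordChar n}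
      zero_mem' := ⟨0, 0, (zero_zsmul _).symm⟩
      add_mem' := by
        rintro _ _ ⟨m, n, rfl⟩ ⟨m', n', rfl⟩
        exact ⟨_, _, zsmul_coordChar_add m m' n n'⟩
      neg_mem' := by
        rintro _ ⟨m, n, rfl⟩
        exact ⟨-m, n, (neg_zsmul _ _).symm⟩ }
  refine mem_of_separatesPoints (solenoidHaar fun _ => 2) D (fun x x' hxx' => ?_) y
  by_contra! h
  exact hxx' (Subtype.ext (funext fun n => h (coordChar n) ⟨1, n, (one_zsmul _).symm⟩))

theorem exists_apply_ne {x x' : DyadicSolenoid} (h : x ≠ x') :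
    ∃ y : CharGroup DyadicSolenoid, y x ≠ y x' := by
  by_contra! h'
  exact h (Subtype.ext (funext fun n => h' (coordChar n)))

theorem mem_dyadicRationals_iff {q : ℚ} :
    q ∈ DyadicRationals ↔ ∃ (m : ℤ) (n : ℕ), q = m / 2 ^ n := by
  change (∃ (m : ℤ) (n : ℕ), q = m / ∏ i ∈ Finset.range n, (((2 : ℕ) : ℚ))) ↔ _
  simp

/-- The character group of the dyadic solenoid is the group of dyadic rationals. -/
theorem nonempty_charGroup_addEquiv : Nonempty (CharGroup DyadicSolenoid ≃+ DyadicRationals) := by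
  choose m n hmn using fun q : DyadicRationals => mem_dyadicRationals_iff.1 q.2
  have key : ∀ (q : DyadicRationals) (k : ℤ) (l : ℕ),
      m q • coordChar (n q) = k • coordChar l ↔ (q : ℚ) = k / 2 ^ l := by
    intro q k l
    rw [zsmul_coordChar_eq_iff, hmn q, div_eq_div_iff (by positivity) (by positivity)]
    norm_cast
  let f : DyadicRationals →+ CharGroup DyadicSolenoid :=
    AddMonoidHom.mk' (fun q => m q • coordChar (n q)) fun q q' => by
      rw [zsmul_coordChar_add, key, AddSubgroup.coe_add]
      nth_rewrite 1 [hmn q, hmn q']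
      push_cast
      rw [pow_add]
      field_simp
  refine ⟨(AddEquiv.ofBijective f ⟨fun q q' h => ?_, fun y => ?_⟩).symm⟩
  · exact Subtype.ext (((key q _ _).1 h).trans (hmn q').symm)
  · obtain ⟨k, l, rfl⟩ := exists_eq_zsmul_coordChar y
    exact ⟨⟨k / 2 ^ l, mem_dyadicRationals_iff.2 ⟨k, l, rfl⟩⟩, (key _ _ _).2 rfl⟩

/-- For $w=m/2^n$ the relation reads $3m=k2^n$; as 3 is prime to $2^n$ it divides $k$, so $k=0$ and
$m=0$. -/
theorem eq_zero_of_three_zsmul_eq {k : ℤ} {w : CharGroup DyadicSolenoid} (hk : |k| ≤ 2)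
    (h : (3 : ℤ) • w = k • coordChar 0) : w = 0 := by
  obtain ⟨m, n, rfl⟩ := exists_eq_zsmul_coordChar w
  rw [← mul_zsmul, zsmul_coordChar_eq_iff, pow_zero, mul_one] at h
  have h3 : (3 : ℤ) ∣ k := by
    have : IsCoprime (3 : ℤ) (2 ^ n) := IsCoprime.pow_right (by norm_num)
    exact this.dvd_of_dvd_mul_right ⟨m, h.symm⟩
  have hk0 : k = 0 := Int.eq_zero_of_abs_lt_dvd h3 (by omega)
  rw [hk0, zero_mul] at h
  have hm : m = 0 := by omega
  rw [hm, zero_zsmul]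

end DyadicSolenoid

/-! ### Automorphisms of the dyadic solenoid -/

namespace DyadicSolenoid

/-- Endomorphisms of the dyadic solenoid are determined by their zeroth coordinate. -/
theorem addMonoidHom_eq_zero_of_apply_zero {f : DyadicSolenoid →+ DyadicSolenoid}
    (h : ∀ x, (f x : ℕ → UnitAddCircle) 0 = 0) (x : DyadicSolenoid) : f x = 0 := by
  refine Subtype.ext (funext fun k => ?_)
  -- The `k`-th coordinate of $f(2^kz)=2^kf(z)$ is the zeroth coordinate of $f(z)$.
  obtain ⟨z, rfl⟩ := exists_two_pow_zsmul_eq x k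
  rw [map_zsmul]
  have hz := two_pow_zsmul_apply_add (f z) 0 k
  rw [h, zero_add] at hz
  exact hz

theorem exists_ne_zero_zsmul_eq_zero {p : ℤ} (hp : Odd p) (hp1 : 1 < p) :
    ∃ x : DyadicSolenoid, x ≠ 0 ∧ p • x = 0 := by
  obtain ⟨s, hs⟩ := hp
  have hp0 : (p : ℝ) ≠ 0 := by
    have : p ≠ 0 := by omega
    exact_mod_cast this
  have hsp : (2 : ℝ) * ((s + 1 : ℤ) : ℝ) = p + 1 := by
    rw [hs]
    push_cast
    ring
  -- As $p=2s+1$, the integer $s+1$ inverts 2 modulo $p$; its powers over $p$ give a compatible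
  -- sequence of $p$-torsion points.
  let x : DyadicSolenoid := ⟨fun n => ((((s + 1 : ℤ) : ℝ) ^ n / p : ℝ) : UnitAddCircle), fun n => by
    rw [← AddCircle.coe_nsmul, ← sub_eq_zero, ← AddCircle.coe_sub, AddCircle.coe_eq_zero_iff]
    refine ⟨(s + 1) ^ n, ?_⟩
    rw [zsmul_eq_mul, nsmul_eq_mul, pow_succ, mul_one, Int.cast_pow]
    field_simp
    linear_combination (-((s + 1 : ℤ) : ℝ) ^ n) * hsp⟩
  refine ⟨x, fun h => ?_, Subtype.ext (funext fun n => ?_)⟩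
  · have h0 : ((((s + 1 : ℤ) : ℝ) ^ 0 / p : ℝ) : UnitAddCircle) = 0 :=
      congr_fun (congr_arg Subtype.val h) 0
    obtain ⟨j, hj⟩ := (AddCircle.coe_eq_zero_iff (1 : ℝ)).1 h0
    rw [zsmul_eq_mul, mul_one, pow_zero, eq_div_iff hp0] at hj
    have hj' : j * p = 1 := by exact_mod_cast hj
    have := Int.eq_one_or_neg_one_of_mul_eq_one' hj'
    omega
  · change p • ((((s + 1 : ℤ) : ℝ) ^ n / p : ℝ) : UnitAddCircle) = 0
    rw [← AddCircle.coe_zsmul, AddCircle.coe_eq_zero_iff]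
    refine ⟨(s + 1) ^ n, ?_⟩
    rw [zsmul_eq_mul, zsmul_eq_mul, mul_one, Int.cast_pow]
    field_simp

/-- Multiplications by `± 2 ^ k`, other than the identity, for which `x ↦ x + f x` is injective. -/
theorem eq_neg_two_zsmul_of_ker_eq_bot {f : DyadicSolenoid → DyadicSolenoid} {ε : ℤ}
    (hε : ε = 1 ∨ ε = -1) (k : ℕ) (hf : ∀ x, f x = (ε * 2 ^ k) • x) (hid : ∃ x, f x ≠ x)
    (hker : ∀ x, x + f x = 0 → x = 0) (x : DyadicSolenoid) : f x = (-2 : ℤ) • x := by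
  -- Otherwise a nonzero $p$-torsion point would be killed by $I+f$.
  have key : ∀ p : ℤ, Odd p → 1 < p → ¬ p ∣ 1 + ε * 2 ^ k := by
    rintro p hp hp1 ⟨c, hc⟩
    obtain ⟨z, hz0, hz⟩ := exists_ne_zero_zsmul_eq_zero hp hp1
    refine hz0 (hker z ?_)
    nth_rewrite 1 [hf, ← one_zsmul z]
    rw [← add_zsmul, hc, mul_comm, mul_zsmul, hz, zsmul_zero]
  have hpow : ∀ j : ℕ, (2 : ℤ) ^ (j + 1) = 2 * 2 ^ j ∧ (0 : ℤ) < 2 ^ j :=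
    fun j => ⟨pow_succ' _ _, by positivity⟩
  rcases hε with rfl | rfl
  · cases k with
    | zero =>
      obtain ⟨z, hz⟩ := hid
      exact absurd (by rw [hf, pow_zero, mul_one, one_zsmul]) hz
    | succ k =>
      obtain ⟨h1, h2⟩ := hpow k
      exact absurd (by rw [one_mul])
        (key (1 + 2 ^ (k + 1)) ⟨2 ^ k, by omega⟩ (by omega))
  · match k with
    -- For $f=-I$ the multiplier $1+\varepsilon 2^k$ is 0, divisible by 3.
    | 0 => exact absurd (by norm_num) (key 3 (by decide) (by norm_num))
    | 1 => rw [hf]; norm_num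
    | k + 2 =>
      obtain ⟨h1, h2⟩ := hpow k
      have h3 : (2 : ℤ) ^ (k + 2) = 2 * 2 ^ (k + 1) := pow_succ' _ _
      exact absurd ⟨-1, by ring⟩ (key (2 ^ (k + 2) - 1) ⟨2 ^ (k + 1) - 1, by omega⟩ (by omega))

/-- Pulling the zeroth coordinate back along `α` and its inverse gives $m/2^n$ and $m'/2^{n'}$ in
the dual. Their product is 1, so $m$ is plus or minus a power of 2. -/
theorem exists_two_pow_zsmul_apply_eq (α : DyadicSolenoid ≃ₜ+ DyadicSolenoid) :
    ∃ (ε : ℤ) (n j : ℕ), (ε = 1 ∨ ε = -1) ∧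
      ∀ x, (2 : ℤ) ^ n • α x = (ε * 2 ^ j) • x := by
  obtain ⟨m, n, h⟩ := exists_eq_zsmul_coordChar
    ((coordChar 0).comp ⟨(α : DyadicSolenoid →+ DyadicSolenoid), α.continuous⟩)
  obtain ⟨m', n', h'⟩ := exists_eq_zsmul_coordChar
    ((coordChar 0).comp ⟨(α.symm : DyadicSolenoid →+ DyadicSolenoid), α.symm.continuous⟩)
  have hα : ∀ x : DyadicSolenoid, (α x : ℕ → UnitAddCircle) 0 =
      m • (x : ℕ → UnitAddCircle) n := fun x => by
    have := DFunLike.congr_fun h x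
    rwa [charGroup_zsmul_apply] at this
  have hα' : ∀ x : DyadicSolenoid, (x : ℕ → UnitAddCircle) 0 =
      m' • (α x : ℕ → UnitAddCircle) n' := fun x => by
    have := DFunLike.congr_fun h' (α x)
    rw [charGroup_zsmul_apply] at this
    refine Eq.trans ?_ this
    exact congr_arg (fun z : DyadicSolenoid => (z : ℕ → UnitAddCircle) 0)
      (α.symm_apply_apply x).symm
  have hprod : (2 : ℤ) ^ n' • coordChar 0 = (m' * m) • coordChar n := by
    refine ContinuousAddMonoidHom.ext fun x => ?_
    rw [charGroup_zsmul_apply, charGroup_zsmul_apply, coordChar_apply, coordChar_apply, mul_zsmul,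
      ← hα, hα', ← mul_zsmul, mul_comm, mul_zsmul]
    have := two_pow_zsmul_apply_add (α x) 0 n'
    rw [zero_add] at this
    rw [this]
  rw [zsmul_coordChar_eq_iff, pow_zero, mul_one, ← pow_add] at hprod
  obtain ⟨j, -, hj⟩ := (Nat.dvd_prime_pow Nat.prime_two).1
    (show m.natAbs ∣ 2 ^ (n' + n) from by
      have := Int.natAbs_dvd_natAbs.2 (Dvd.intro_left _ hprod.symm)
      rwa [Int.natAbs_pow] at this)
  have hm : ∃ ε : ℤ, (ε = 1 ∨ ε = -1) ∧ m = ε * 2 ^ j := by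
    rcases Int.natAbs_eq m with hm | hm
    · exact ⟨1, Or.inl rfl, by rw [hm, hj]; push_cast; ring⟩
    · exact ⟨-1, Or.inr rfl, by rw [hm, hj]; push_cast; ring⟩
  obtain ⟨ε, hε, hm⟩ := hm
  refine ⟨ε, n, j, hε, fun x => ?_⟩
  have hzero := addMonoidHom_eq_zero_of_apply_zero
    (f := (2 : ℤ) ^ n • (α : DyadicSolenoid →+ DyadicSolenoid) -
      m • AddMonoidHom.id DyadicSolenoid) (fun z => by
      change (2 : ℤ) ^ n • (α z : ℕ → UnitAddCircle) 0 - m • (z : ℕ → UnitAddCircle) 0 = 0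
      have hz := two_pow_zsmul_apply_add z 0 n
      rw [zero_add] at hz
      rw [hα, ← hz, ← mul_zsmul, ← mul_zsmul, mul_comm, sub_self]) x
  rw [← hm]
  exact sub_eq_zero.1 hzero

/-- An automorphism `α ≠ I` with `Ker (I + α) = 0` is multiplication by `-2` or its inverse. -/
theorem apply_eq_or_symm_apply_eq (α : DyadicSolenoid ≃ₜ+ DyadicSolenoid)
    (hα : α ≠ ContinuousAddEquiv.refl DyadicSolenoid) (hker : ∀ x, x + α x = 0 → x = 0) :
    (∀ x, α x = (-2 : ℤ) • x) ∨ ∀ x, α.symm x = (-2 : ℤ) • x := by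
  obtain ⟨ε, n, j, hε, h⟩ := exists_two_pow_zsmul_apply_eq α
  have hid : ∃ x, α x ≠ x := by
    by_contra! h
    exact hα (ContinuousAddEquiv.ext h)
  rcases le_total n j with hnj | hnj
  · obtain ⟨k, rfl⟩ := Nat.exists_eq_add_of_le hnj
    refine Or.inl (eq_neg_two_zsmul_of_ker_eq_bot hε k (fun x => ?_) hid hker)
    refine sub_eq_zero.1 (eq_zero_of_two_pow_zsmul n ?_)
    rw [zsmul_sub, h, ← mul_zsmul, pow_add, mul_left_comm, sub_self]
  -- Here the inverse of `α` is the integral multiplication, and both hypotheses pass to it.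
  · obtain ⟨k, rfl⟩ := Nat.exists_eq_add_of_le hnj
    refine Or.inr (eq_neg_two_zsmul_of_ker_eq_bot hε k (fun x => ?_) ?_ fun x hx => ?_)
    · refine sub_eq_zero.1 (eq_zero_of_two_pow_zsmul j ?_)
      have hx := h (α.symm x)
      rw [α.apply_symm_apply] at hx
      have hεε : ε * ε = 1 := by rcases hε with rfl | rfl <;> norm_num
      have h1 : (2 : ℤ) ^ j • α.symm x = (ε * 2 ^ (j + k)) • x := by
        rw [mul_zsmul, hx, ← mul_zsmul, ← mul_assoc, hεε, one_mul]
      rw [zsmul_sub, h1, ← mul_zsmul, pow_add, mul_left_comm, sub_self]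
    · obtain ⟨z, hz⟩ := hid
      exact ⟨z, fun h => hz (by nth_rewrite 1 [← h]; exact α.apply_symm_apply z)⟩
    · have hx' : α.symm x = 0 := hker _ (by rw [α.apply_symm_apply, add_comm, hx])
      rw [← α.apply_symm_apply x, hx', map_zero]

end DyadicSolenoid

/-! ### Heyde's functional equation -/

section Heyde

variable {X : Type*} [AddCommGroup X] [TopologicalSpace X] [IsTopologicalAddGroup X]
  [SecondCountableTopology X] [MeasurableSpace X] [BorelSpace X]

/-- The Fourier transform of the joint law of `L₁ = ξ₁ + ξ₂` and `L₂ = ξ₁ + α ξ₂`. -/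
theorem characteristicFunction_map_add_add (μ ν : Measure X) [IsFiniteMeasure μ]
    [IsFiniteMeasure ν] (f g : X →ₜ+ X) (y : CharGroup (X × X)) :
    characteristicFunction ((μ.prod ν).map fun ω => (ω.1 + ω.2, f ω.1 + g ω.2)) y =
      characteristicFunction μ (y.comp (.inl X X) + (y.comp (.inr X X)).comp f) *
        characteristicFunction ν (y.comp (.inl X X) + (y.comp (.inr X X)).comp g) := by
  have hf : Continuous f := f.continuous_toFun
  have hg : Continuous g := g.continuous_toFun
  rw [characteristicFunction, integral_map (by fun_prop)
    (continuous_charValue y).measurable.aestronglyMeasurable]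
  refine Eq.trans (integral_congr_ae (Filter.Eventually.of_forall fun ω => ?_))
    (integral_prod_mul (μ := μ) (ν := ν) (fun x => charValue x _) fun x => charValue x _)
  have hω : ((ω.1 + ω.2, f ω.1 + g ω.2) : X × X) =
      ((ω.1, 0) + (0, f ω.1)) + ((ω.2, 0) + (0, g ω.2)) := by
    simp
  simp only [hω, charValue_add_left, charValue_add]
  rfl

/-- The functional equation of Heyde's theorem implies conditional symmetry. -/
theorem isSymmetricCondDistrib_of_characteristicFunction_eq [CompactSpace X] [T2Space X]
    [StandardBorelSpace X]
    (hX : ∀ x x' : X, x ≠ x' → ∃ y : CharGroup X, y x ≠ y x') (μ ν : Measure X)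
    [IsFiniteMeasure μ] [IsFiniteMeasure ν] (α : X →ₜ+ X)
    (h : ∀ u v : CharGroup X,
      characteristicFunction μ (u + v) * characteristicFunction ν (u + v.comp α) =
        characteristicFunction μ (u - v) * characteristicFunction ν (u - v.comp α)) :
    IsSymmetricCondDistrib (fun ω : X × X => ω.1 + α ω.2) (fun ω => ω.1 + ω.2) (μ.prod ν) := by
  have hα : Continuous α := α.continuous_toFun
  refine isSymmetricCondDistrib_of_map_eq (by fun_prop) ?_
  refine ext_of_characteristicFunction_eq (fun x x' hxx' => ?_) fun y => ?_
  · by_contra! hy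
    have h1 : x.1 = x'.1 := by
      by_contra hne
      obtain ⟨y, hy'⟩ := hX _ _ hne
      exact hy' (hy (y.comp (.fst X X)))
    have h2 : x.2 = x'.2 := by
      by_contra hne
      obtain ⟨y, hy'⟩ := hX _ _ hne
      exact hy' (hy (y.comp (.snd X X)))
    exact hxx' (Prod.ext h1 h2)
  -- Changing the sign of $L_2$ replaces the pair $(I,\alpha)$ by $(-I,-\alpha)$, which on the
  -- Fourier side is $v\mapsto -v$.
  · have hneg : (fun ω : X × X => (ω.1 + ω.2, -(ω.1 + α ω.2))) =
        fun ω => (ω.1 + ω.2, (-ContinuousAddMonoidHom.id X : X →ₜ+ X) ω.1 + (-α) ω.2) := by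
      funext ω
      exact Prod.ext rfl (neg_add _ _)
    have h1 := characteristicFunction_map_add_add μ ν (ContinuousAddMonoidHom.id X) α y
    have h2 := characteristicFunction_map_add_add μ ν (-ContinuousAddMonoidHom.id X) (-α) y
    have hcomp : ∀ (v : CharGroup X) (f : X →ₜ+ X), v.comp (-f) = -(v.comp f) := fun v f =>
      ContinuousAddMonoidHom.ext fun x => map_neg v (f x)
    rw [hcomp, hcomp, ← sub_eq_add_neg, ← sub_eq_add_neg] at h2
    rw [hneg, h2]
    exact h1.trans (h _ _)

end Heyde

/-! ### The counterexample -/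

namespace DyadicSolenoid

theorem coordChar_zero_ne_zero : coordChar 0 ≠ 0 := fun h =>
  one_ne_zero (zsmul_coordChar_eq_zero_iff.1 ((one_zsmul (coordChar 0)).trans h))

/-- The distribution on the dyadic solenoid with density `1 + cos (2π x₀)`. -/
noncomputable def cosineDistribution : Measure DyadicSolenoid :=
  cosineMeasure (solenoidHaar fun _ => 2) (coordChar 0)

instance : IsProbabilityMeasure cosineDistribution :=
  isProbabilityMeasure_cosineMeasure _ coordChar_zero_ne_zero

theorem cosineDistribution_notMem_gaussianConvHaar :
    cosineDistribution ∉ gaussianConvHaar DyadicSolenoid := by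
  intro h
  have hne : ∀ k : ℤ, k ≠ 2 → coordChar 0 + coordChar 0 ≠ k • coordChar 0 := by
    intro k hk heq
    rw [← two_zsmul, zsmul_coordChar_eq_iff, pow_zero, mul_one, mul_one] at heq
    exact hk heq.symm
  have h0 : coordChar 0 + coordChar 0 ≠ 0 := by
    have := hne 0 (by norm_num)
    rwa [zero_zsmul] at this
  refine characteristicFunction_add_self_ne_zero_of_mem_gaussianConvHaar h (y := coordChar 0) ?_ ?_
  · rw [cosineDistribution,
      characteristicFunction_cosineMeasure_self _ coordChar_zero_ne_zero h0]
    norm_num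
  · refine characteristicFunction_cosineMeasure_eq_zero _ h0 ?_ ?_
    · simpa only [one_zsmul] using hne 1 (by norm_num)
    · simpa only [neg_zsmul, one_zsmul] using hne (-1) (by norm_num)

theorem isSymmetricCondDistrib_cosineDistribution (α : DyadicSolenoid ≃ₜ+ DyadicSolenoid)
    (hα : (∀ x, α x = (-2 : ℤ) • x) ∨ ∀ x, α.symm x = (-2 : ℤ) • x) :
    IsSymmetricCondDistrib (fun ω : DyadicSolenoid × DyadicSolenoid => ω.1 + α ω.2)
      (fun ω => ω.1 + ω.2) (cosineDistribution.prod cosineDistribution) := by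
  have key := characteristicFunction_cosineMeasure_mul_eq (solenoidHaar fun _ => 2)
    (p := coordChar 0) fun k w => eq_zero_of_three_zsmul_eq
  let β : DyadicSolenoid →ₜ+ DyadicSolenoid :=
    ⟨(α : DyadicSolenoid →+ DyadicSolenoid), α.continuous⟩
  refine isSymmetricCondDistrib_of_characteristicFunction_eq (fun x x' => exists_apply_ne)
    cosineDistribution cosineDistribution β fun u v => ?_
  generalize hw : v.comp β = w
  have hwx : ∀ x, w x = v (α x) := fun x => by rw [← hw]; rfl
  rcases hα with hα | hα
  · have h : w = -((2 : ℤ) • v) := ContinuousAddMonoidHom.ext fun x => by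
      rw [hwx, hα, map_zsmul, ← neg_zsmul, charGroup_zsmul_apply]
    rw [h, ← sub_eq_add_neg, sub_neg_eq_add]
    exact key u v
  -- For the inverse of $-2$ the two characters exchange roles, so the same identity applies with
  -- the factors swapped.
  · have h : v = -((2 : ℤ) • w) := ContinuousAddMonoidHom.ext fun x => by
      rw [← neg_zsmul, charGroup_zsmul_apply, hwx, ← map_zsmul, ← map_zsmul, ← hα,
        α.apply_symm_apply]
    rw [h, ← sub_eq_add_neg, sub_neg_eq_add, mul_comm]
    exact (key u w).trans (mul_comm _ _)

end DyadicSolenoid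

theorem proposition4p5 :
    CompactSpace DyadicSolenoid ∧
    T2Space DyadicSolenoid ∧
    SecondCountableTopology DyadicSolenoid ∧
    ConnectedSpace DyadicSolenoid ∧
    DiscreteTopology (CharGroup DyadicSolenoid) ∧
    Nonempty (CharGroup DyadicSolenoid ≃+ DyadicRationals) ∧
    (∀ x : DyadicSolenoid, addOrderOf x ≠ 2) ∧
    ∀ α : DyadicSolenoid ≃ₜ+ DyadicSolenoid,
      α ≠ ContinuousAddEquiv.refl DyadicSolenoid →
      (AddMonoidHom.id DyadicSolenoid + (α : DyadicSolenoid →+ DyadicSolenoid)).ker = ⊥ →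
      ∃ (Ω : Type) (_ : MeasurableSpace Ω) (P : Measure Ω) (_ : IsProbabilityMeasure P)
        (ξ₁ ξ₂ : Ω → DyadicSolenoid),
        Measurable ξ₁ ∧ Measurable ξ₂ ∧ IndepFun ξ₁ ξ₂ P ∧
        IsSymmetricCondDistrib (fun ω => ξ₁ ω + α (ξ₂ ω)) (fun ω => ξ₁ ω + ξ₂ ω) P ∧
        P.map ξ₁ ∉ gaussianConvHaar DyadicSolenoid ∧
        P.map ξ₂ ∉ gaussianConvHaar DyadicSolenoid := by
  refine ⟨inferInstance, inferInstance, inferInstance, inferInstance,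
    discreteTopology_charGroup (solenoidHaar fun _ => 2),
    DyadicSolenoid.nonempty_charGroup_addEquiv, DyadicSolenoid.addOrderOf_ne_two, ?_⟩
  intro α hα hker
  have hker' : ∀ x, x + α x = 0 → x = 0 := fun x hx => by
    rw [← AddSubgroup.mem_bot, ← hker]
    exact hx
  let P := DyadicSolenoid.cosineDistribution.prod DyadicSolenoid.cosineDistribution
  have h₁ : P.map Prod.fst = DyadicSolenoid.cosineDistribution := by
    simp [P]
  have h₂ : P.map Prod.snd = DyadicSolenoid.cosineDistribution := by
    simp [P]
  refine ⟨DyadicSolenoid × DyadicSolenoid, inferInstance, P, inferInstance, Prod.fst, Prod.snd,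
    measurable_fst, measurable_snd,
    indepFun_prod (X := id) (Y := id) measurable_id measurable_id,
    DyadicSolenoid.isSymmetricCondDistrib_cosineDistribution α
      (DyadicSolenoid.apply_eq_or_symm_apply_eq α hα hker'), ?_, ?_⟩
  · rw [h₁]
    exact DyadicSolenoid.cosineDistribution_notMem_gaussianConvHaar
  · rw [h₂]
    exact DyadicSolenoid.cosineDistribution_notMem_gaussianConvHaar
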